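/- Let $M$ be a smooth pseudo-Riemannian manifold, let $m\in M$, write $V=T_mM$ with scalar product $\langle\cdot,\cdot\rangle$, and let $H$ be the holonomy group of $M$ at $m$ (all parallel transports for the Levi-Civita connection along piecewise smooth loops based at $m$). For a subspace $W\subseteq V$ put $W^H=\{w\in W: hw=w \text{ for all } h\in H\}$ and $S(W,H)=\operatorname{span}\{w-hw: w\in W,\ h\in H\}$; call $W$ isotropic if $\langle x,y\rangle=0$ for all $x,y\in W$, and nondegenerate if the restriction of $\langle\cdot,\cdot\rangle$ to $W$ is nondegenerate. Assume that $V^H$ is not isotropic. (1) There is an orthogonal decomposition $V=M^0\oplus M^1$ into $H$-invariant subspaces such that $M^0\subseteq V^H$ is nondegenerate and $(M^1)^H$ is isotropic. (2) This decomposition is unique up to a distance-preserving linear map, in the following explicit form. Let $V=M^0\oplus M^1=N^0\oplus N^1$ be two decompositions as in (1), and let $p_0,p_1$ be the projections of $V$ onto $N^0,N^1$ associated with $V=N^0\oplus N^1$. Then $M^1$ has a basis $e_1,\dots,e_r,a_1,\dots,a_k,f_1,\dots,f_r$ (for some $r,k\ge 0$) such that $e_1,\dots,e_r$ span $(M^1)^H$,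 the vectors $e_1,\dots,e_r,a_1,\dots,a_k$ span $S(M^1,H)$, and the Gram matrix of the basis is $$\begin{pmatrix}0&0&I_r\\0&A&0\\I_r&0&0\end{pmatrix},\qquad A=\operatorname{diag}(\varepsilon_1,\dots,\varepsilon_k),\quad \varepsilon_j=\pm1 .$$ For every such basis of $M^1$ there is a bijective linear map $\pi:V\to V$ with $\langle\pi x,\pi y\rangle=\langle x,y\rangle$ for all $x,y\in V$, $\pi(M^0)=N^0$ and $\pi(M^1)=N^1$, which is given by $\pi(x)=p_0(x)$ for $x\in M^0$, $\pi(e_i)=e_i$, $\pi(a_j)=a_j$, and $$\pi(f_s)=p_1(f_s)+\tfrac12\langle p_0f_s,p_0f_s\rangle\,e_s+\sum_{l=s+1}^{r}\langle p_0f_s,p_0f_l\rangle\,e_l\qquad(1\le s\le r).$$ -/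

import Mathlib

open Set Bundle
open scoped Manifold ContDiff Matrix

namespace PseudoRiem

/-! ### Linear algebra of a group acting on a real vector space with a symmetric bilinear form -/

section LinearAlgebra

variable {V : Type*} [AddCommGroup V] [Module ℝ V]

/-- The subspace of vectors of `W` that are fixed by every element of `G`. For `W = ⊤` this is
the maximal trivial subspace of `G`. -/
def fixedIn (G : Subgroup (V ≃ₗ[ℝ] V)) (W : Submodule ℝ V) : Submodule ℝ V where
  carrier := {v | v ∈ W ∧ ∀ h ∈ G, h v = v}
  zero_mem' := ⟨W.zero_mem, fun h _ => map_zero h⟩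
  add_mem' := fun {a b} ha hb =>
    ⟨W.add_mem ha.1 hb.1, fun h hh => by rw [map_add, ha.2 h hh, hb.2 h hh]⟩
  smul_mem' := fun c a ha => ⟨W.smul_mem c ha.1, fun h hh => by rw [map_smul, ha.2 h hh]⟩

/-- The subspace `S(W, G)` spanned by the vectors `v - h v` with `v ∈ W` and `h ∈ G`. -/
def displacementSpan (G : Subgroup (V ≃ₗ[ℝ] V)) (W : Submodule ℝ V) : Submodule ℝ V :=
  Submodule.span ℝ {x | ∃ v ∈ W, ∃ h ∈ G, x = v - h v}

/-- The form vanishes identically on `W`. -/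
def IsIsotropic (B : LinearMap.BilinForm ℝ V) (W : Submodule ℝ V) : Prop :=
  ∀ x ∈ W, ∀ y ∈ W, B x y = 0

/-- `V = W₀ ⊕ W₁` is an orthogonal decomposition into `G`-invariant subspaces, with `W₀` a
nondegenerate subspace of the fixed space of `G`, and with the fixed space of `W₁` isotropic. -/
structure IsFixedSplitting (B : LinearMap.BilinForm ℝ V) (G : Subgroup (V ≃ₗ[ℝ] V))
    (W₀ W₁ : Submodule ℝ V) : Prop where
  isCompl : IsCompl W₀ W₁
  orthogonal : ∀ x ∈ W₀, ∀ y ∈ W₁, B x y = 0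
  invariant₀ : ∀ h ∈ G, ∀ x ∈ W₀, h x ∈ W₀
  invariant₁ : ∀ h ∈ G, ∀ x ∈ W₁, h x ∈ W₁
  le_fixed : W₀ ≤ fixedIn G ⊤
  nondegenerate : (B.restrict W₀).Nondegenerate
  isotropic : IsIsotropic B (fixedIn G W₁)

/-- A hyperbolic-type basis `e₁, …, e_r, a₁, …, a_k, f₁, …, f_r` of `W`: the `eᵢ` span the fixed
space of `W`, the `eᵢ` and `aⱼ` together span `S(W, G)`, and the Gram matrix of the basis is
`[[0, 0, 1], [0, diag ε, 0], [1, 0, 0]]` with all `εⱼ = ± 1`. -/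
structure IsHyperbolicBasis (B : LinearMap.BilinForm ℝ V) (G : Subgroup (V ≃ₗ[ℝ] V))
    (W : Submodule ℝ V) {r k : ℕ} (b : Module.Basis (Fin r ⊕ Fin k ⊕ Fin r) ℝ W) : Prop where
  span_e : Submodule.span ℝ (range fun i : Fin r => (b (.inl i) : V)) = fixedIn G W
  span_ea : Submodule.span ℝ ((range fun i : Fin r => (b (.inl i) : V)) ∪
      range fun j : Fin k => (b (.inr (.inl j)) : V)) = displacementSpan G W
  ee : ∀ i i' : Fin r, B (b (.inl i)) (b (.inl i')) = 0
  ea : ∀ (i : Fin r) (j : Fin k), B (b (.inl i)) (b (.inr (.inl j))) = 0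
  ef : ∀ i i' : Fin r, B (b (.inl i)) (b (.inr (.inr i'))) = if i = i' then 1 else 0
  aa : ∀ j j' : Fin k, j ≠ j' → B (b (.inr (.inl j))) (b (.inr (.inl j'))) = 0
  aa_self : ∀ j : Fin k, B (b (.inr (.inl j))) (b (.inr (.inl j))) = 1 ∨
    B (b (.inr (.inl j))) (b (.inr (.inl j))) = -1
  af : ∀ (j : Fin k) (i : Fin r), B (b (.inr (.inl j))) (b (.inr (.inr i))) = 0
  ff : ∀ i i' : Fin r, B (b (.inr (.inr i))) (b (.inr (.inr i'))) = 0

end LinearAlgebra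

/-! ### Pseudo-Riemannian metrics, parallel transport and holonomy -/

section Manifold

variable {E : Type*} [NormedAddCommGroup E] [NormedSpace ℝ E]
  {M : Type*} [TopologicalSpace M] [ChartedSpace E M] [IsManifold 𝓘(ℝ, E) ∞ M]

variable (E M) in
/-- A pseudo-Riemannian metric: a smooth field of nondegenerate symmetric bilinear forms on the
tangent spaces of `M`. -/
structure PseudoRiemannianMetric where
  inner (p : M) : TangentSpace 𝓘(ℝ, E) p →L[ℝ] TangentSpace 𝓘(ℝ, E) p →L[ℝ] ℝ
  symm (p : M) (v w : TangentSpace 𝓘(ℝ, E) p) : inner p v w = inner p w v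
  nondegenerate (p : M) (v : TangentSpace 𝓘(ℝ, E) p) (hv : ∀ w, inner p v w = 0) : v = 0
  contMDiff : ContMDiff 𝓘(ℝ, E) (𝓘(ℝ, E).prod 𝓘(ℝ, E →L[ℝ] E →L[ℝ] ℝ)) ∞
    (fun p ↦ TotalSpace.mk' (E →L[ℝ] E →L[ℝ] ℝ)
      (E := fun p : M ↦ TangentSpace 𝓘(ℝ, E) p →L[ℝ] TangentSpace 𝓘(ℝ, E) p →L[ℝ] ℝ)
      p (inner p))

/-- The scalar product on the tangent space at `m`, as a bilinear form. -/
noncomputable def PseudoRiemannianMetric.form (g : PseudoRiemannianMetric E M) (m : M) :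
    LinearMap.BilinForm ℝ (TangentSpace 𝓘(ℝ, E) m) :=
  LinearMap.mk₂ ℝ (fun v w => g.inner m v w)
    (fun v v' w => by simp) (fun c v w => by simp) (fun v w w' => by simp) (fun c v w => by simp)

/-- The metric read in the chart centred at `c`: the coefficients `g_y(u, v)`, for `y` in the image
of the chart and `u`, `v` in the model space. (On the chart domain, the trivialization of the
tangent bundle at `c` is the differential of that chart.) -/
noncomputable def PseudoRiemannianMetric.inChart (g : PseudoRiemannianMetric E M) (c : M)
    (y u v : E) : ℝ :=
  let p : M := (extChartAt 𝓘(ℝ, E) c).symm y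
  g.inner p ((trivializationAt E (TangentSpace 𝓘(ℝ, E)) c).symmL ℝ p u)
    ((trivializationAt E (TangentSpace 𝓘(ℝ, E)) c).symmL ℝ p v)

/-- The Christoffel symbols of the first kind of the Levi-Civita connection in the chart centred at
`c`, contracted with `a`, `b`, `w`:
`Γ(a, b; w) = (∂_a g(b, w) + ∂_b g(a, w) - ∂_w g(a, b)) / 2`, i.e. `g(∇_a b, w)` for
constant coefficient vector fields `a`, `b`, `w`. -/
noncomputable def PseudoRiemannianMetric.christoffel (g : PseudoRiemannianMetric E M) (c : M)
    (y a b w : E) : ℝ :=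
  (fderiv ℝ (fun z => g.inChart c z b w) y a + fderiv ℝ (fun z => g.inChart c z a w) y b
    - fderiv ℝ (fun z => g.inChart c z a b) y w) / 2

theorem PseudoRiemannianMetric.inChart_zero (g : PseudoRiemannianMetric E M) (c : M)
    (y v : E) : g.inChart c y 0 v = 0 := by
  simp only [PseudoRiemannianMetric.inChart, map_zero]
  rfl

theorem PseudoRiemannianMetric.inChart_neg (g : PseudoRiemannianMetric E M) (c : M)
    (y u v : E) : g.inChart c y (-u) v = -g.inChart c y u v := by
  simp only [PseudoRiemannianMetric.inChart, map_neg]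
  rfl

theorem PseudoRiemannianMetric.christoffel_zero (g : PseudoRiemannianMetric E M) (c : M)
    (y b w : E) : g.christoffel c y 0 b w = 0 := by
  simp [PseudoRiemannianMetric.christoffel, g.inChart_zero]

theorem PseudoRiemannianMetric.christoffel_neg (g : PseudoRiemannianMetric E M) (c : M)
    (y a b w : E) : g.christoffel c y (-a) b w = -g.christoffel c y a b w := by
  simp only [PseudoRiemannianMetric.christoffel, g.inChart_neg, fderiv_fun_neg, map_neg, neg_apply]
  ring

/-- `X` is a vector field along the curve `γ : [0, 1] → M` that is parallel for the Levi-Civita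
connection of `g`. In every chart, the coordinates `x` of the curve and `ξ` of the field satisfy
`ξ' + Γ(x', ξ) = 0`; the last line is this equation paired with arbitrary `w` through `g`. -/
def PseudoRiemannianMetric.IsParallelAlong (g : PseudoRiemannianMetric E M)
    (γ : ℝ → M) (X : ℝ → TangentBundle 𝓘(ℝ, E) M) : Prop :=
  (∀ t ∈ Icc (0 : ℝ) 1, (X t).proj = γ t) ∧
  ∀ t ∈ Icc (0 : ℝ) 1, ∀ c : M, γ t ∈ (chartAt E c).source →
    ∃ x' ξ' : E,
      HasDerivWithinAt (fun s => extChartAt 𝓘(ℝ, E) c (γ s)) x' (Icc 0 1) t ∧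
      HasDerivWithinAt (fun s => (trivializationAt E (TangentSpace 𝓘(ℝ, E)) c (X s)).2) ξ'
        (Icc 0 1) t ∧
      ∀ w : E, g.inChart c (extChartAt 𝓘(ℝ, E) c (γ t)) ξ' w
        + g.christoffel c (extChartAt 𝓘(ℝ, E) c (γ t)) x'
          (trivializationAt E (TangentSpace 𝓘(ℝ, E)) c (X t)).2 w = 0

/-- `g.IsTransport p q L`: the map `L : T_p M → T_q M` is the parallel transport along some
piecewise smooth curve from `p` to `q`, that is, along a finite concatenation of smooth curves. -/
inductive PseudoRiemannianMetric.IsTransport (g : PseudoRiemannianMetric E M) :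
    (p q : M) → (TangentSpace 𝓘(ℝ, E) p ≃ₗ[ℝ] TangentSpace 𝓘(ℝ, E) q) → Prop
  | smooth (p q : M) (L : TangentSpace 𝓘(ℝ, E) p ≃ₗ[ℝ] TangentSpace 𝓘(ℝ, E) q) (γ : ℝ → M)
      (hγ : ContMDiffOn 𝓘(ℝ, ℝ) 𝓘(ℝ, E) ∞ γ (Icc 0 1)) (h0 : γ 0 = p) (h1 : γ 1 = q)
      (hL : ∀ v : TangentSpace 𝓘(ℝ, E) p, ∃ X : ℝ → TangentBundle 𝓘(ℝ, E) M,
        g.IsParallelAlong γ X ∧ X 0 = ⟨p, v⟩ ∧ X 1 = ⟨q, L v⟩) :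
      IsTransport g p q L
  | trans (p q r : M) (L : TangentSpace 𝓘(ℝ, E) p ≃ₗ[ℝ] TangentSpace 𝓘(ℝ, E) q)
      (L' : TangentSpace 𝓘(ℝ, E) q ≃ₗ[ℝ] TangentSpace 𝓘(ℝ, E) r) :
      IsTransport g p q L → IsTransport g q r L' → IsTransport g p r (L.trans L')

theorem PseudoRiemannianMetric.IsTransport.refl (g : PseudoRiemannianMetric E M) (p : M) :
    g.IsTransport p p (LinearEquiv.refl ℝ _) := by
  refine .smooth p p _ (fun _ => p) contMDiffOn_const rfl rfl fun v =>
    ⟨fun _ => ⟨p, v⟩, ⟨fun _ _ => rfl, fun t _ c _ => ⟨0, 0, hasDerivWithinAt_const _ _ _,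
      hasDerivWithinAt_const _ _ _, fun w => ?_⟩⟩, rfl, rfl⟩
  rw [g.christoffel_zero, g.inChart_zero, add_zero]

theorem PseudoRiemannianMetric.IsTransport.symm {g : PseudoRiemannianMetric E M} {p q : M}
    {L : TangentSpace 𝓘(ℝ, E) p ≃ₗ[ℝ] TangentSpace 𝓘(ℝ, E) q} (h : g.IsTransport p q L) :
    g.IsTransport q p L.symm := by
  induction h with
  | trans p q r L L' _ _ ih ih' => exact .trans _ _ _ _ _ ih' ih
  | smooth p q L γ hγ h0 h1 hL =>
    have hmaps : MapsTo (fun t : ℝ => 1 - t) (Icc 0 1) (Icc 0 1) := fun t ht =>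
      ⟨by linarith [ht.2], by linarith [ht.1]⟩
    have hd : ∀ t : ℝ, HasDerivWithinAt (fun t : ℝ => 1 - t) (-1) (Icc 0 1) t := fun t => by
      simpa using ((hasDerivAt_id t).const_sub 1).hasDerivWithinAt
    refine .smooth q p _ (fun t => γ (1 - t)) (hγ.comp ?_ hmaps) (by simpa using h1)
      (by simpa using h0) fun v => ?_
    · exact (contDiff_const.sub contDiff_id).contMDiff.contMDiffOn
    · obtain ⟨X, ⟨hX, hX'⟩, hX0, hX1⟩ := hL (L.symm v)
      refine ⟨fun t => X (1 - t), ⟨fun t ht => hX _ (hmaps ht), fun t ht c hc => ?_⟩,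
        by simpa using hX1, by simpa using hX0⟩
      obtain ⟨x', ξ', h1, h2, h3⟩ := hX' _ (hmaps ht) c hc
      refine ⟨-x', -ξ', ?_, ?_, fun w => ?_⟩
      · simpa [Function.comp_def] using h1.scomp t (hd t) hmaps
      · simpa [Function.comp_def] using h2.scomp t (hd t) hmaps
      · have := h3 w
        rw [g.christoffel_neg, g.inChart_neg]
        linarith

/-- The holonomy group of `g` at `m`: all parallel transports along piecewise smooth loops
based at `m`. -/
noncomputable def PseudoRiemannianMetric.holonomy (g : PseudoRiemannianMetric E M) (m : M) :
    Subgroup (TangentSpace 𝓘(ℝ, E) m ≃ₗ[ℝ] TangentSpace 𝓘(ℝ, E) m) where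
  carrier := {L | g.IsTransport m m L}
  mul_mem' := fun {L L'} hL hL' => .trans m m m L' L hL' hL
  one_mem' := .refl g m
  inv_mem' := fun {_} hL => hL.symm

end Manifold

end PseudoRiem

/-!
The geometry enters only through the fact that the holonomy group `H` acts by isometries. In a
chart, the Christoffel symbols of the first kind satisfy `Γ(a, b; w) + Γ(a, w; b) = ∂_a g(b, w)`, so
the scalar product of two parallel fields along a curve has zero derivative
(`PseudoRiemannianMetric.IsParallelAlong.inner_eq`); hence parallel transport is isometric.

The rest is linear algebra of a group of isometries of a nondegenerate form. The fixed space `F` and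
the displacement space `S(V, H)` are orthogonal complements of each other, so they share the radical
`R = F ∩ F^⊥`. A splitting arises from a nondegenerate complement `W₀` of `R` in `F` and
`W₁ = W₀^⊥`. Conversely, for every splitting the fixed space of `W₁` is `R`
(`IsFixedSplitting.fixedIn_eq`) and `S(W₁, H) = S(V, H)` (`IsFixedSplitting.displacementSpan_eq`):
neither depends on the splitting.

For a hyperbolic basis of `W₁`, the `eᵢ` are a basis of `R`, the `aⱼ` a pseudo-orthonormal basis of
a complement of `R` in `S(V, H)`, and the `fᵢ` are partners of the `eᵢ` made isotropic by adding
combinations of the `eᵢ` (`IsFixedSplitting.exists_isHyperbolicBasis`).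

Given a second splitting `N₀ ⊕ N₁`, the `eᵢ` and `aⱼ` lie in `N₁` by this independence. The
projection `p₀` is isometric on `F`, since it changes vectors of `F` by elements of `R` only. On the
`f_s`, the projection `p₁` keeps the products with the `eᵢ` and `aⱼ` but gives
`⟨p₁ f_s, p₁ f_t⟩ = -⟨p₀ f_s, p₀ f_t⟩`, and the multiples of the `e_l` in the formula cancel exactly
this defect (`IsFixedSplitting.form_correctedProjection`).
-/

namespace PseudoRiem

/-! ### Parallel transport is isometric -/

section Derivative

/-- The product rule for a variable bilinear form evaluated on two variable vectors. -/
theorem _root_.DifferentiableAt.hasDerivWithinAt_clm_apply₂ {E F : Type*}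
    [NormedAddCommGroup E] [NormedSpace ℝ E] [NormedAddCommGroup F] [NormedSpace ℝ F]
    {k : E → F →L[ℝ] F →L[ℝ] ℝ} {x : ℝ → E} {ξ η : ℝ → F} {x' : E} {ξ' η' : F} {s : Set ℝ} {t : ℝ}
    (hk : DifferentiableAt ℝ k (x t)) (hx : HasDerivWithinAt x x' s t)
    (hξ : HasDerivWithinAt ξ ξ' s t) (hη : HasDerivWithinAt η η' s t) :
    HasDerivWithinAt (fun r => k (x r) (ξ r) (η r))
      (fderiv ℝ k (x t) x' (ξ t) (η t) + k (x t) ξ' (η t) + k (x t) (ξ t) η') s t := by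
  have h : HasDerivWithinAt (fun r => k (x r)) (fderiv ℝ k (x t) x') s t :=
    HasFDerivAt.comp_hasDerivWithinAt (F := E) (E := F →L[ℝ] F →L[ℝ] ℝ) (l := k) t
      hk.hasFDerivAt hx
  have h' : HasDerivWithinAt (fun r => k (x r) (ξ r))
      (fderiv ℝ k (x t) x' (ξ t) + k (x t) ξ') s t :=
    HasDerivWithinAt.clm_apply (G := F →L[ℝ] ℝ) h hξ
  simpa using HasDerivWithinAt.clm_apply h' hη

end Derivative

section Transport

variable {E : Type*} [NormedAddCommGroup E] [NormedSpace ℝ E]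
  {M : Type*} [TopologicalSpace M] [ChartedSpace E M] [IsManifold 𝓘(ℝ, E) ∞ M]

/-- The metric read in the chart centred at `c`, bundled as a field on the model space of
continuous bilinear forms, so that it can be differentiated. -/
noncomputable def PseudoRiemannianMetric.chartForm (g : PseudoRiemannianMetric E M) (c : M)
    (y : E) : E →L[ℝ] E →L[ℝ] ℝ :=
  let p : M := (extChartAt 𝓘(ℝ, E) c).symm y
  let s := (trivializationAt E (TangentSpace 𝓘(ℝ, E)) c).symmL ℝ p
  (ContinuousLinearMap.precomp ℝ s).comp ((g.inner p).comp s)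

theorem PseudoRiemannianMetric.chartForm_apply (g : PseudoRiemannianMetric E M) (c : M)
    (y u v : E) : g.chartForm c y u v = g.inChart c y u v := rfl

theorem PseudoRiemannianMetric.contMDiffOn_inner_symmL (g : PseudoRiemannianMetric E M) (c : M)
    (u v : E) :
    ContMDiffOn 𝓘(ℝ, E) 𝓘(ℝ, ℝ) ∞
      (fun p => g.inner p ((trivializationAt E (TangentSpace 𝓘(ℝ, E)) c).symmL ℝ p u)
        ((trivializationAt E (TangentSpace 𝓘(ℝ, E)) c).symmL ℝ p v))
      (trivializationAt E (TangentSpace 𝓘(ℝ, E)) c).baseSet := by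
  have hs : ∀ u : E, ContMDiffOn 𝓘(ℝ, E) (𝓘(ℝ, E).prod 𝓘(ℝ, E)) ∞
      (fun p => TotalSpace.mk' E (E := fun p : M => TangentSpace 𝓘(ℝ, E) p) p
        ((trivializationAt E (TangentSpace 𝓘(ℝ, E)) c).symmL ℝ p u))
      (trivializationAt E (TangentSpace 𝓘(ℝ, E)) c).baseSet := by
    intro u
    rw [(trivializationAt E (TangentSpace 𝓘(ℝ, E)) c).contMDiffOn_section_baseSet_iff]
    refine (contMDiffOn_const (c := u)).congr fun p hp => ?_
    rw [← Trivialization.continuousLinearMapAt_apply_of_mem (R := ℝ) _ hp]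
    exact Trivialization.continuousLinearMapAt_symmL _ hp u
  have h : ContMDiffOn 𝓘(ℝ, E) (𝓘(ℝ, E).prod 𝓘(ℝ, ℝ)) ∞
      (fun p => TotalSpace.mk' ℝ (E := Bundle.Trivial M ℝ) p
        (g.inner p ((trivializationAt E (TangentSpace 𝓘(ℝ, E)) c).symmL ℝ p u)
        ((trivializationAt E (TangentSpace 𝓘(ℝ, E)) c).symmL ℝ p v)))
      (trivializationAt E (TangentSpace 𝓘(ℝ, E)) c).baseSet := 
    ContMDiffOn.clm_bundle_apply₂ (F₁ := E) (F₂ := E) g.contMDiff.contMDiffOn (hs u) (hs v)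
  intro p hp
  have := h p hp
  simp only [contMDiffWithinAt_totalSpace] at this
  exact this.2

theorem PseudoRiemannianMetric.contDiffOn_inChart (g : PseudoRiemannianMetric E M) (c : M)
    (u v : E) :
    ContDiffOn ℝ ∞ (fun y => g.inChart c y u v) (extChartAt 𝓘(ℝ, E) c).target := by
  rw [← contMDiffOn_iff_contDiffOn]
  refine (g.contMDiffOn_inner_symmL c u v).comp (contMDiffOn_extChartAt_symm c) fun y hy => ?_
  rw [mem_preimage, TangentBundle.trivializationAt_baseSet, ← extChartAt_source 𝓘(ℝ, E)]
  exact (extChartAt 𝓘(ℝ, E) c).map_target hy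

theorem PseudoRiemannianMetric.differentiableAt_chartForm [FiniteDimensional ℝ E]
    (g : PseudoRiemannianMetric E M) {c : M} {y : E} (hy : y ∈ (extChartAt 𝓘(ℝ, E) c).target) :
    DifferentiableAt ℝ (g.chartForm c) y := by
  have : ContDiffOn ℝ ∞ (g.chartForm c) (extChartAt 𝓘(ℝ, E) c).target :=
    contDiffOn_clm_apply.2 fun u => contDiffOn_clm_apply.2 fun v => g.contDiffOn_inChart c u v
  exact (this.contDiffAt ((isOpen_extChartAt_target c).mem_nhds hy)).differentiableAt (by simp)

theorem PseudoRiemannianMetric.inChart_symm (g : PseudoRiemannianMetric E M) (c : M)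
    (y u v : E) : g.inChart c y u v = g.inChart c y v u :=
  g.symm _ _ _

/-- The Christoffel symbols of the first kind define a metric connection:
`Γ(a, b; w) + Γ(a, w; b) = ∂_a g(b, w)`. -/
theorem PseudoRiemannianMetric.christoffel_add_christoffel [FiniteDimensional ℝ E]
    (g : PseudoRiemannianMetric E M) {c : M} {y : E} (hy : y ∈ (extChartAt 𝓘(ℝ, E) c).target)
    (a b w : E) :
    g.christoffel c y a b w + g.christoffel c y a w b = fderiv ℝ (g.chartForm c) y a b w := by
  have hd := g.differentiableAt_chartForm hy
  have h : fderiv ℝ (fun z => g.inChart c z b w) y a = fderiv ℝ (g.chartForm c) y a b w := by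
    have h1 := ((hd.hasFDerivAt.clm_apply (hasFDerivAt_const b y)).clm_apply
      (hasFDerivAt_const w y)).fderiv
    simp only [chartForm_apply] at h1
    rw [h1]
    simp
  simp only [christoffel, g.inChart_symm c _ w b]
  rw [← h]
  ring

/-- Evaluating the metric in any chart around the base point, on the coordinates of two tangent
vectors, gives their scalar product. -/
theorem PseudoRiemannianMetric.inChart_trivializationAt (g : PseudoRiemannianMetric E M)
    {c p : M} (hp : p ∈ (chartAt E c).source) (v w : TangentSpace 𝓘(ℝ, E) p) :
    g.inChart c (extChartAt 𝓘(ℝ, E) c p)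
      (trivializationAt E (TangentSpace 𝓘(ℝ, E)) c ⟨p, v⟩).2
      (trivializationAt E (TangentSpace 𝓘(ℝ, E)) c ⟨p, w⟩).2 = g.inner p v w := by
  have hb : p ∈ (trivializationAt E (TangentSpace 𝓘(ℝ, E)) c).baseSet := by
    rwa [TangentBundle.trivializationAt_baseSet]
  rw [← Trivialization.continuousLinearMapAt_apply_of_mem (R := ℝ) _ hb,
    ← Trivialization.continuousLinearMapAt_apply_of_mem (R := ℝ) _ hb]
  have key : ∀ q : M, q = p →
      g.inner q ((trivializationAt E (TangentSpace 𝓘(ℝ, E)) c).symmL ℝ q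
          ((trivializationAt E (TangentSpace 𝓘(ℝ, E)) c).continuousLinearMapAt ℝ p v))
        ((trivializationAt E (TangentSpace 𝓘(ℝ, E)) c).symmL ℝ q
          ((trivializationAt E (TangentSpace 𝓘(ℝ, E)) c).continuousLinearMapAt ℝ p w))
        = g.inner p v w := by
    rintro q rfl
    rw [Trivialization.symmL_continuousLinearMapAt _ hb,
      Trivialization.symmL_continuousLinearMapAt _ hb]
  exact key _ ((extChartAt 𝓘(ℝ, E) c).left_inv (by rwa [extChartAt_source]))

/-- The coordinate expression of the scalar product of two tangent vectors at the same point does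
not depend on the chart. -/
theorem PseudoRiemannianMetric.inChart_trivializationAt_eq (g : PseudoRiemannianMetric E M)
    {c c' p : M} (hp : p ∈ (chartAt E c).source) (hp' : p ∈ (chartAt E c').source)
    {X Y : TangentBundle 𝓘(ℝ, E) M} (hX : X.proj = p) (hY : Y.proj = p) :
    g.inChart c (extChartAt 𝓘(ℝ, E) c p)
      (trivializationAt E (TangentSpace 𝓘(ℝ, E)) c X).2
      (trivializationAt E (TangentSpace 𝓘(ℝ, E)) c Y).2 =
    g.inChart c' (extChartAt 𝓘(ℝ, E) c' p)
      (trivializationAt E (TangentSpace 𝓘(ℝ, E)) c' X).2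
      (trivializationAt E (TangentSpace 𝓘(ℝ, E)) c' Y).2 := by
  obtain ⟨q, v⟩ := X
  obtain ⟨q', w⟩ := Y
  obtain rfl : q = p := hX
  obtain rfl : q' = q := hY
  rw [g.inChart_trivializationAt hp, g.inChart_trivializationAt hp']

/-- The scalar product of two parallel vector fields along a curve is constant. -/
theorem PseudoRiemannianMetric.IsParallelAlong.inner_eq [FiniteDimensional ℝ E]
    {g : PseudoRiemannianMetric E M} {γ : ℝ → M} (hγ : ContinuousOn γ (Icc 0 1))
    {X Y : ℝ → TangentBundle 𝓘(ℝ, E) M} (hX : g.IsParallelAlong γ X)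
    (hY : g.IsParallelAlong γ Y) {p q : M} {v w : TangentSpace 𝓘(ℝ, E) p}
    {v' w' : TangentSpace 𝓘(ℝ, E) q} (hX0 : X 0 = ⟨p, v⟩) (hX1 : X 1 = ⟨q, v'⟩)
    (hY0 : Y 0 = ⟨p, w⟩) (hY1 : Y 1 = ⟨q, w'⟩) :
    g.inner q v' w' = g.inner p v w := by
  set G : M → ℝ → ℝ := fun c t => g.inChart c (extChartAt 𝓘(ℝ, E) c (γ t))
    (trivializationAt E (TangentSpace 𝓘(ℝ, E)) c (X t)).2
    (trivializationAt E (TangentSpace 𝓘(ℝ, E)) c (Y t)).2 with hG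
  have hderiv : ∀ t ∈ Icc (0 : ℝ) 1, ∀ c : M, γ t ∈ (chartAt E c).source →
      HasDerivWithinAt (G c) 0 (Icc 0 1) t := by
    intro t ht c hc
    obtain ⟨x', ξ', hx, hξ, hparX⟩ := hX.2 t ht c hc
    obtain ⟨y', η', hy, hη, hparY⟩ := hY.2 t ht c hc
    obtain rfl : y' = x' := (uniqueDiffOn_Icc_zero_one t ht).eq_deriv _ hy hx
    have htarget : extChartAt 𝓘(ℝ, E) c (γ t) ∈ (extChartAt 𝓘(ℝ, E) c).target :=
      (extChartAt 𝓘(ℝ, E) c).map_source (by rwa [extChartAt_source])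
    have h := (g.differentiableAt_chartForm htarget).hasDerivWithinAt_clm_apply₂ hx hξ hη
    refine h.congr_deriv ?_
    have h1 := hparX (trivializationAt E (TangentSpace 𝓘(ℝ, E)) c (Y t)).2
    have h2 := hparY (trivializationAt E (TangentSpace 𝓘(ℝ, E)) c (X t)).2
    have h3 := g.christoffel_add_christoffel htarget y'
      (trivializationAt E (TangentSpace 𝓘(ℝ, E)) c (X t)).2
      (trivializationAt E (TangentSpace 𝓘(ℝ, E)) c (Y t)).2
    rw [g.inChart_symm] at h2
    simp only [g.chartForm_apply, ← h3]
    linarith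
  -- Near `t`, the chart centred at the moving point `γ s` may be replaced by the one at `γ t`.
  have hlocal : ∀ t ∈ Icc (0 : ℝ) 1,
      HasDerivWithinAt (fun s => G (γ s) s) 0 (Icc 0 1) t := by
    intro t ht
    have hmem : ∀ᶠ s in nhdsWithin t (Icc (0 : ℝ) 1), γ s ∈ (chartAt E (γ t)).source :=
      (hγ t ht).eventually ((chartAt E (γ t)).open_source.mem_nhds (mem_chart_source E (γ t)))
    refine (hderiv t ht (γ t) (mem_chart_source E _)).congr_of_eventuallyEq ?_ rfl
    filter_upwards [hmem, self_mem_nhdsWithin] with s hs hs'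
    exact g.inChart_trivializationAt_eq (mem_chart_source E _) hs (hX.1 s hs') (hY.1 s hs')
  have hconst : G (γ 1) 1 = G (γ 0) 0 :=
    constant_of_derivWithin_zero (fun t ht => (hlocal t ht).differentiableWithinAt)
      (fun t ht => (hlocal t (Ico_subset_Icc_self ht)).derivWithin
        (uniqueDiffOn_Icc_zero_one t (Ico_subset_Icc_self ht))) 1 (right_mem_Icc.2 zero_le_one)
  have h0 : γ 0 = p := by rw [← hX.1 0 (left_mem_Icc.2 zero_le_one), hX0]
  have h1 : γ 1 = q := by rw [← hX.1 1 (right_mem_Icc.2 zero_le_one), hX1]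
  simp only [hG, h0, h1, hX0, hX1, hY0, hY1] at hconst
  rwa [g.inChart_trivializationAt (mem_chart_source E q),
    g.inChart_trivializationAt (mem_chart_source E p)] at hconst

/-- Parallel transport along a piecewise smooth curve is an isometry. -/
theorem PseudoRiemannianMetric.IsTransport.inner_apply_apply [FiniteDimensional ℝ E]
    {g : PseudoRiemannianMetric E M} {p q : M}
    {L : TangentSpace 𝓘(ℝ, E) p ≃ₗ[ℝ] TangentSpace 𝓘(ℝ, E) q} (hL : g.IsTransport p q L)
    (v w : TangentSpace 𝓘(ℝ, E) p) : g.inner q (L v) (L w) = g.inner p v w := by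
  induction hL with
  | smooth p q L γ hγ h0 h1 hL =>
    obtain ⟨X, hX, hX0, hX1⟩ := hL v
    obtain ⟨Y, hY, hY0, hY1⟩ := hL w
    exact hX.inner_eq hγ.continuousOn hY hX0 hX1 hY0 hY1
  | trans p q r L L' _ _ ih ih' => exact (ih' _ _).trans (ih v w)

end Transport

/-! ### Existence and invariants of splittings -/

section LinearAlgebra

variable {V : Type*} [AddCommGroup V] [Module ℝ V]

theorem fixedIn_le (G : Subgroup (V ≃ₗ[ℝ] V)) (W : Submodule ℝ V) : fixedIn G W ≤ W :=
  fun _ hv => hv.1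

theorem fixedIn_mono (G : Subgroup (V ≃ₗ[ℝ] V)) {W W' : Submodule ℝ V} (hW : W ≤ W') :
    fixedIn G W ≤ fixedIn G W' :=
  fun _ hv => ⟨hW hv.1, hv.2⟩

/-- Every subspace `W` splits as its radical plus a nondegenerate subspace. -/
theorem exists_nondegenerate_compl_radical {B : LinearMap.BilinForm ℝ V} (hB : B.IsSymm)
    (W : Submodule ℝ V) :
    ∃ A ≤ W, Disjoint (W ⊓ B.orthogonal W) A ∧ (W ⊓ B.orthogonal W) ⊔ A = W ∧
      (B.restrict A).Nondegenerate := by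
  obtain ⟨C, hC⟩ := Submodule.exists_isCompl (W ⊓ B.orthogonal W)
  have hsup : (W ⊓ B.orthogonal W) ⊔ C ⊓ W = W := by
    rw [← sup_inf_assoc_of_le C inf_le_left, hC.sup_eq_top, top_inf_eq]
  refine ⟨C ⊓ W, inf_le_right, hC.disjoint.mono_right inf_le_left, hsup, ?_⟩
  refine B.nondegenerate_restrict_of_disjoint_orthogonal hB.isRefl ?_
  rw [Submodule.disjoint_def]
  intro x hx hx'
  refine Submodule.disjoint_def.1 hC.disjoint x ⟨hx.2, fun w hw => ?_⟩ hx.1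
  rw [← hsup] at hw
  obtain ⟨r, hr, a, ha, rfl⟩ := Submodule.mem_sup.1 hw
  have h1 : B r x = 0 := hB.isRefl _ _ (hr.2 x hx.2)
  have h2 : B a x = 0 := hx' a ha
  show B (r + a) x = 0
  rw [map_add, LinearMap.add_apply, h1, h2, add_zero]

/-- A nondegenerate real symmetric form has an orthogonal basis of vectors of square `± 1`. -/
theorem exists_pseudoOrthonormal_basis [FiniteDimensional ℝ V] {B : LinearMap.BilinForm ℝ V}
    (hB : B.IsSymm) (hB' : B.Nondegenerate) :
    ∃ a : Module.Basis (Fin (Module.finrank ℝ V)) ℝ V,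
      (∀ i j, i ≠ j → B (a i) (a j) = 0) ∧ ∀ i, B (a i) (a i) = 1 ∨ B (a i) (a i) = -1 := by
  obtain ⟨v, hv⟩ := LinearMap.BilinForm.exists_orthogonal_basis
    (LinearMap.BilinForm.isSymm_iff.1 hB)
  have hne : ∀ i, B (v i) (v i) ≠ 0 := hv.not_isOrtho_basis_self_of_separatingLeft hB'.1
  have hpos : ∀ i, 0 < Real.sqrt |B (v i) (v i)| := fun i => Real.sqrt_pos.2 (abs_pos.2 (hne i))
  refine ⟨v.isUnitSMul (w := fun i => (Real.sqrt |B (v i) (v i)|)⁻¹)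
    fun i => (inv_ne_zero (hpos i).ne').isUnit, fun i j hij => ?_, fun i => ?_⟩
  · have : B (v i) (v j) = 0 := hv hij
    simp [Module.Basis.isUnitSMul_apply, this]
  · simp only [Module.Basis.isUnitSMul_apply, map_smul, LinearMap.smul_apply, smul_eq_mul]
    rw [← mul_assoc, ← mul_inv, Real.mul_self_sqrt (abs_nonneg _)]
    rcases abs_cases (B (v i) (v i)) with ⟨h, -⟩ | ⟨h, -⟩
    · left; rw [h, inv_mul_cancel₀ (hne i)]
    · right; rw [h, inv_neg, neg_mul, inv_mul_cancel₀ (hne i)]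

/-- Linearly independent vectors admit biorthogonal partners for a nondegenerate form. -/
theorem exists_biorthogonal [FiniteDimensional ℝ V] {B : LinearMap.BilinForm ℝ V}
    (hB : B.IsSymm) (hB' : B.Nondegenerate) {ι : Type*} [DecidableEq ι] {e : ι → V}
    (he : LinearIndependent ℝ e) :
    ∃ f : ι → V, ∀ i j, B (e i) (f j) = if i = j then 1 else 0 := by
  have hφ : ∀ j, ∃ φ : V →ₗ[ℝ] ℝ, ∀ i, φ (e i) = if i = j then 1 else 0 := fun j => by
    obtain ⟨φ, hφ⟩ := (Finsupp.lapply j ∘ₗ he.repr).exists_extend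
    refine ⟨φ, fun i => ?_⟩
    have h := LinearMap.congr_fun hφ ⟨e i, Submodule.subset_span (mem_range_self i)⟩
    have h' := he.repr_eq_single i ⟨e i, Submodule.subset_span (mem_range_self i)⟩ rfl
    simpa [h', Finsupp.single_apply] using h
  choose φ hφ using hφ
  refine ⟨fun j => (B.toDual hB').symm (φ j), fun i j => ?_⟩
  rw [hB.eq, LinearMap.BilinForm.apply_toDual_symm_apply, hφ]

/-- A family with biorthogonal partners is linearly independent. -/
theorem linearIndependent_of_biorthogonal {B : LinearMap.BilinForm ℝ V} {ι : Type*}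
    [DecidableEq ι] {v w : ι → V} (h : ∀ i j, B (v i) (w j) = if i = j then 1 else 0) :
    LinearIndependent ℝ v := by
  rw [linearIndependent_iff']
  intro s c hc i hi
  have := congrArg (fun x => B x (w i)) hc
  simpa [LinearMap.sum_apply, h, hi] using this

section Isometries

variable {B : LinearMap.BilinForm ℝ V} {G : Subgroup (V ≃ₗ[ℝ] V)}

/-- For a group of isometries of a nondegenerate form, the fixed space is the orthogonal complement
of the displacement space. -/
theorem orthogonal_displacementSpan_top (hB' : B.Nondegenerate)
    (hG : ∀ h ∈ G, ∀ x y, B (h x) (h y) = B x y) :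
    B.orthogonal (displacementSpan G ⊤) = fixedIn G ⊤ := by
  ext x
  constructor
  · refine fun hx => ⟨trivial, fun h hh => ?_⟩
    rw [← sub_eq_zero]
    refine hB'.2 _ fun y => ?_
    have hy : B (h.symm y - h (h.symm y)) x = 0 :=
      hx _ (Submodule.subset_span ⟨h.symm y, trivial, h, hh, rfl⟩)
    rw [h.apply_symm_apply, map_sub, LinearMap.sub_apply] at hy
    have h' := hG h hh (h.symm y) x
    rw [h.apply_symm_apply] at h'
    rw [map_sub, h']
    exact hy
  · intro hx y hy
    induction hy using Submodule.span_induction with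
    | mem y hy =>
      obtain ⟨v, -, h, hh, rfl⟩ := hy
      have := hG h hh v x
      rw [hx.2 h hh] at this
      show B (v - h v) x = 0
      rw [map_sub, LinearMap.sub_apply, this, sub_self]
    | zero => exact LinearMap.map_zero₂ B x
    | add y z _ _ hy hz =>
      show B (y + z) x = 0
      rw [map_add, LinearMap.add_apply, show B y x = 0 from hy, show B z x = 0 from hz, add_zero]
    | smul c y _ hy =>
      show B (c • y) x = 0
      rw [map_smul, LinearMap.smul_apply, show B y x = 0 from hy, smul_zero]

theorem orthogonal_fixedIn_top [FiniteDimensional ℝ V] (hB : B.IsSymm) (hB' : B.Nondegenerate)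
    (hG : ∀ h ∈ G, ∀ x y, B (h x) (h y) = B x y) :
    B.orthogonal (fixedIn G ⊤) = displacementSpan G ⊤ := by
  rw [← orthogonal_displacementSpan_top hB' hG,
    LinearMap.BilinForm.orthogonal_orthogonal hB' hB.isRefl]

/-- The splitting exists: a nondegenerate complement of the radical in the fixed space, together
with its orthogonal complement. -/
theorem exists_isFixedSplitting [FiniteDimensional ℝ V] (hB : B.IsSymm)
    (hG : ∀ h ∈ G, ∀ x y, B (h x) (h y) = B x y) :
    ∃ W₀ W₁ : Submodule ℝ V, IsFixedSplitting B G W₀ W₁ := by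
  obtain ⟨A, hAF, -, hsup, hA⟩ := exists_nondegenerate_compl_radical hB (fixedIn G ⊤)
  refine ⟨A, B.orthogonal A, LinearMap.BilinForm.isCompl_orthogonal_of_restrict_nondegenerate
    hB.isRefl hA, fun x hx y hy => hy x hx, fun h hh x hx => ?_, fun h hh x hx y hy => ?_,
    hAF, hA, fun x hx y hy => ?_⟩
  · rwa [(hAF hx).2 h hh]
  · show B y (h x) = 0
    rw [← (hAF hy).2 h hh, hG h hh]
    exact hx y hy
  · have hyF : y ∈ fixedIn G ⊤ := fixedIn_mono G le_top hy
    rw [← hsup] at hyF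
    obtain ⟨z, hz, a, ha, rfl⟩ := Submodule.mem_sup.1 hyF
    have h1 : B x z = 0 := hz.2 x (fixedIn_mono G le_top hx)
    have h2 : B x a = 0 := hB.isRefl _ _ (hx.1 a ha)
    rw [map_add, h1, h2, add_zero]

namespace IsFixedSplitting

variable {W₀ W₁ : Submodule ℝ V}

theorem exists_add_eq (hW : IsFixedSplitting B G W₀ W₁) {y : V} (hy : y ∈ fixedIn G ⊤) :
    ∃ y₀ ∈ W₀, ∃ y₁ ∈ fixedIn G W₁, y₀ + y₁ = y := by
  obtain ⟨y₀, h₀, y₁, h₁, rfl⟩ := Submodule.mem_sup.1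
    (hW.isCompl.sup_eq_top ▸ Submodule.mem_top : y ∈ W₀ ⊔ W₁)
  refine ⟨y₀, h₀, y₁, ⟨h₁, fun h hh => ?_⟩, rfl⟩
  have := hy.2 h hh
  rwa [map_add, (hW.le_fixed h₀).2 h hh, add_right_inj] at this

theorem sup_fixedIn (hW : IsFixedSplitting B G W₀ W₁) :
    W₀ ⊔ fixedIn G W₁ = fixedIn G ⊤ :=
  le_antisymm (sup_le hW.le_fixed (fixedIn_mono G le_top)) fun _ hy =>
    Submodule.mem_sup.2 (hW.exists_add_eq hy)

/-- The fixed space of `W₁` is the radical of the fixed space of `V`; in particular it does not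
depend on the splitting. -/
theorem fixedIn_eq (hW : IsFixedSplitting B G W₀ W₁) :
    fixedIn G W₁ = fixedIn G ⊤ ⊓ B.orthogonal (fixedIn G ⊤) := by
  ext x
  constructor
  · refine fun hx => ⟨fixedIn_mono G le_top hx, fun y hy => ?_⟩
    obtain ⟨y₀, h₀, y₁, h₁, rfl⟩ := hW.exists_add_eq hy
    show B (y₀ + y₁) x = 0
    rw [map_add, LinearMap.add_apply, hW.orthogonal _ h₀ _ hx.1, hW.isotropic _ h₁ _ hx, add_zero]
  · intro hx
    obtain ⟨x₀, h₀, x₁, h₁, rfl⟩ := hW.exists_add_eq hx.1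
    have : (⟨x₀, h₀⟩ : W₀) = 0 := hW.nondegenerate.2 _ fun y => by
      have h : B y (x₀ + x₁) = 0 := hx.2 y (hW.le_fixed y.2)
      rwa [map_add, hW.orthogonal _ y.2 _ h₁.1, add_zero] at h
    obtain rfl : x₀ = 0 := congrArg Subtype.val this
    rwa [zero_add]

/-- Vectors of `W₀` are fixed, so only the `W₁`-component of a vector is displaced. -/
theorem displacementSpan_eq (hW : IsFixedSplitting B G W₀ W₁) :
    displacementSpan G W₁ = displacementSpan G ⊤ := by
  refine le_antisymm (Submodule.span_mono fun x ⟨v, _, h, hh, hx⟩ => ⟨v, trivial, h, hh, hx⟩)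
    (Submodule.span_mono ?_)
  rintro x ⟨v, -, h, hh, rfl⟩
  obtain ⟨v₀, h₀, v₁, h₁, rfl⟩ := Submodule.mem_sup.1
    (hW.isCompl.sup_eq_top ▸ Submodule.mem_top : v ∈ W₀ ⊔ W₁)
  refine ⟨v₁, h₁, h, hh, ?_⟩
  rw [map_add, (hW.le_fixed h₀).2 h hh]
  abel

theorem displacementSpan_le (hW : IsFixedSplitting B G W₀ W₁) : displacementSpan G W₁ ≤ W₁ := by
  refine Submodule.span_le.2 ?_
  rintro x ⟨v, hv, h, hh, rfl⟩
  exact W₁.sub_mem hv (hW.invariant₁ h hh v hv)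

end IsFixedSplitting

end Isometries

end LinearAlgebra

/-! ### Hyperbolic bases -/

section LinearAlgebra

variable {V : Type*} [AddCommGroup V] [Module ℝ V]
  {B : LinearMap.BilinForm ℝ V} {G : Subgroup (V ≃ₗ[ℝ] V)} {W₀ W₁ : Submodule ℝ V}

theorem span_range_coe_basis {ι : Type*} {W : Submodule ℝ V} (b : Module.Basis ι ℝ W) :
    Submodule.span ℝ (range fun i => (b i : V)) = W := by
  have h := congrArg (Submodule.map W.subtype) b.span_eq
  rwa [Submodule.map_span, ← range_comp, Submodule.map_subtype_top] at h

/-- Biorthogonal partners can be made isotropic by subtracting combinations of the given vectors,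
when these span an isotropic subspace. -/
theorem exists_isotropic_biorthogonal (hB : B.IsSymm) {r : ℕ} {e u : Fin r → V}
    (hee : ∀ i j, B (e i) (e j) = 0) (heu : ∀ i j, B (e i) (u j) = if i = j then 1 else 0) :
    ∃ c : Fin r → Fin r → ℝ, ∀ i j,
      B (u i - ∑ l, c i l • e l) (u j - ∑ l, c j l • e l) = 0 := by
  have hue : ∀ i j, B (u i) (e j) = if i = j then 1 else 0 := fun i j => by
    rw [hB.eq, heu]; simp only [eq_comm]
  refine ⟨fun i l => (1 / 2 : ℝ) * B (u i) (u l), fun i j => ?_⟩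
  simp [LinearMap.sum_apply, hee, heu, hue, hB.eq (u j) (u i)]
  ring

/-- The second summand of every splitting has a hyperbolic basis. The count of basis vectors is
`2 r + k = dim W₁`, from `r + k = dim S(V, G) = dim V - dim V^G` and `dim V^G = dim W₀ + r`. -/
theorem IsFixedSplitting.exists_isHyperbolicBasis [FiniteDimensional ℝ V]
    (hW : IsFixedSplitting B G W₀ W₁) (hB : B.IsSymm) (hB' : B.Nondegenerate)
    (hG : ∀ h ∈ G, ∀ x y, B (h x) (h y) = B x y) :
    ∃ (r k : ℕ) (b : Module.Basis (Fin r ⊕ Fin k ⊕ Fin r) ℝ W₁),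
      IsHyperbolicBasis B G W₁ b := by
  have hF := orthogonal_fixedIn_top hB hB' hG
  have hS : B.orthogonal (displacementSpan G ⊤) = fixedIn G ⊤ :=
    orthogonal_displacementSpan_top hB' hG
  have hR := hW.fixedIn_eq
  obtain ⟨A, hAS, hdisj, hsup, hA⟩ :=
    exists_nondegenerate_compl_radical hB (displacementSpan G ⊤)
  rw [hS, ← hF, inf_comm, ← hR] at hdisj hsup
  rw [hF] at hsup
  have hAW : A ≤ W₁ := hAS.trans (hW.displacementSpan_eq ▸ hW.displacementSpan_le)
  have hRW : fixedIn G W₁ ≤ W₁ := fixedIn_le G W₁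
  have hRA : ∀ x ∈ fixedIn G W₁, ∀ y ∈ A, B x y = 0 := fun x hx y hy => by
    have h1 : x ∈ B.orthogonal (displacementSpan G ⊤) := hS ▸ fixedIn_mono G le_top hx
    exact hB.isRefl _ _ (h1 y (hAS hy))
  let e' := Module.finBasis ℝ (fixedIn G W₁)
  obtain ⟨a', haa, hself⟩ := exists_pseudoOrthonormal_basis (hB.restrict A) hA
  let e : Fin _ → V := fun i => (e' i : V)
  let a : Fin _ → V := fun j => (a' j : V)
  have heR : ∀ i, e i ∈ fixedIn G W₁ := fun i => (e' i).2
  have haA : ∀ j, a j ∈ A := fun j => (a' j).2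
  have hee : ∀ i j, B (e i) (e j) = 0 := fun i j => hW.isotropic _ (heR i) _ (heR j)
  have hea : ∀ i j, B (e i) (a j) = 0 := fun i j => hRA _ (heR i) _ (haA j)
  have hei : LinearIndependent ℝ e :=
    e'.linearIndependent.map' _ (Submodule.ker_subtype _)
  -- Partners of the `e i`, projected onto `W₁` and then onto the orthogonal complement of `A`.
  have hu : ∃ u : Fin _ → V, (∀ j, u j ∈ W₁) ∧ (∀ j, u j ∈ B.orthogonal A) ∧
      ∀ i j, B (e i) (u j) = if i = j then 1 else 0 := by
    obtain ⟨v, hv⟩ := exists_biorthogonal hB hB' hei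
    have hdec : ∀ x : V, ∃ u ∈ W₁, u ∈ B.orthogonal A ∧
        ∀ y ∈ fixedIn G W₁, B y u = B y x := by
      intro x
      obtain ⟨x₀, h₀, x₁, h₁, rfl⟩ := Submodule.mem_sup.1
        (hW.isCompl.sup_eq_top ▸ Submodule.mem_top : x ∈ W₀ ⊔ W₁)
      obtain ⟨z, hz, u, hu, rfl⟩ := Submodule.mem_sup.1
        ((B.isCompl_orthogonal_of_restrict_nondegenerate hB.isRefl hA).sup_eq_top ▸
          Submodule.mem_top : x₁ ∈ A ⊔ B.orthogonal A)
      refine ⟨u, (Submodule.add_mem_iff_right _ (hAW hz)).1 h₁, hu, fun y hy => ?_⟩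
      rw [map_add, map_add, hB.isRefl _ _ (hW.orthogonal _ h₀ _ hy.1), hRA y hy z hz,
        zero_add, zero_add]
    choose u h1 h2 h3 using hdec
    exact ⟨fun j => u (v j), fun j => h1 _, fun j => h2 _, fun i j => by rw [h3 _ _ (heR i), hv]⟩
  obtain ⟨u, huW, huA, heu⟩ := hu
  obtain ⟨c, hc⟩ := exists_isotropic_biorthogonal hB hee heu
  set f : Fin _ → V := fun i => u i - ∑ l, c i l • e l with hf
  have hfW : ∀ j, f j ∈ W₁ := fun j =>
    W₁.sub_mem (huW j) (W₁.sum_mem fun l _ => W₁.smul_mem _ (heR l).1)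
  have hef : ∀ i j, B (e i) (f j) = if i = j then 1 else 0 := fun i j => by
    simp [hf, hee, heu]
  have hff : ∀ i j, B (f i) (f j) = 0 := hc
  have haf : ∀ j i, B (a j) (f i) = 0 := fun j i => by
    have h : B (a j) (u i) = 0 := huA i _ (haA j)
    simp [hf, h, hB.eq (a j) (e _), hea]
  have haa' : ∀ i j, i ≠ j → B (a i) (a j) = 0 := haa
  have hself' : ∀ i, B (a i) (a i) = 1 ∨ B (a i) (a i) = -1 := hself
  have hself'' : ∀ i, B (a i) (a i) * B (a i) (a i) = 1 := fun i => by
    rcases hself' i with h | h <;> simp [h]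
  let v : Fin (Module.finrank ℝ (fixedIn G W₁)) ⊕ Fin (Module.finrank ℝ A) ⊕
    Fin (Module.finrank ℝ (fixedIn G W₁)) → W₁ :=
    Sum.elim (fun i => ⟨e i, (heR i).1⟩)
      (Sum.elim (fun j => ⟨a j, hAW (haA j)⟩) fun i => ⟨f i, hfW i⟩)
  -- Up to signs, the biorthogonal partners exchange `e` and `f`.
  let w : Fin (Module.finrank ℝ (fixedIn G W₁)) ⊕ Fin (Module.finrank ℝ A) ⊕
    Fin (Module.finrank ℝ (fixedIn G W₁)) → W₁ :=
    Sum.elim (fun i => ⟨f i, hfW i⟩)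
      (Sum.elim (fun j => B (a j) (a j) • ⟨a j, hAW (haA j)⟩) fun i => ⟨e i, (heR i).1⟩)
  have hli : LinearIndependent ℝ v := by
    refine linearIndependent_of_biorthogonal (B := B.restrict W₁) (w := w) ?_
    rintro (i | i | i) (j | j | j)
    · simp [v, w, hef]
    · simp [v, w, hea]
    · simp [v, w, hee]
    · simp [v, w, haf]
    · rcases eq_or_ne i j with rfl | hij
      · simpa [v, w] using hself'' i
      · simp [v, w, hij, haa' i j hij]
    · simp [v, w, hB.eq (a _) (e _), hea]
    · simp [v, w, hff]
    · simp [v, w, hB.eq (f _) (a _), haf]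
    · simp [v, w, hB.eq (f _) (e _), hef, eq_comm]
  have hdim : Fintype.card (Fin (Module.finrank ℝ (fixedIn G W₁)) ⊕ Fin (Module.finrank ℝ A) ⊕
      Fin (Module.finrank ℝ (fixedIn G W₁))) = Module.finrank ℝ W₁ := by
    have h1 := Submodule.finrank_add_eq_of_isCompl hW.isCompl
    have h2 := Submodule.finrank_sup_add_finrank_inf_eq (fixedIn G W₁) A
    have h3 := Submodule.finrank_sup_add_finrank_inf_eq W₀ (fixedIn G W₁)
    rw [hdisj.eq_bot, hsup, finrank_bot] at h2
    rw [(hW.isCompl.disjoint.mono_right hRW).eq_bot, hW.sup_fixedIn, finrank_bot] at h3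
    have h4 := LinearMap.BilinForm.finrank_orthogonal hB' (fixedIn G ⊤)
    have h5 := Submodule.finrank_le (fixedIn G (⊤ : Submodule ℝ V))
    rw [hF] at h4
    simp only [Fintype.card_sum, Fintype.card_fin]
    omega
  have hspan_e : Submodule.span ℝ (range e) = fixedIn G W₁ := span_range_coe_basis e'
  have hspan_a : Submodule.span ℝ (range a) = A := span_range_coe_basis a'
  have hspan_ea : Submodule.span ℝ (range e ∪ range a) = displacementSpan G ⊤ := by
    rw [Submodule.span_union, hspan_e, hspan_a, hsup]
  refine ⟨_, _, basisOfLinearIndependentOfCardEqFinrank' v hli hdim,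
    ?_, ?_, ?_, ?_, ?_, ?_, ?_, ?_, ?_⟩ <;>
    simp only [coe_basisOfLinearIndependentOfCardEqFinrank']
  · exact hspan_e
  · exact hspan_ea.trans hW.displacementSpan_eq.symm
  · exact hee
  · exact hea
  · exact hef
  · exact haa'
  · exact hself'
  · exact haf
  · exact hff

end LinearAlgebra

/-! ### Comparison of two splittings -/

section LinearAlgebra

variable {V : Type*} [AddCommGroup V] [Module ℝ V]
  {B : LinearMap.BilinForm ℝ V} {G : Subgroup (V ≃ₗ[ℝ] V)}

/-- If the pieces of a direct sum decomposition lie in those of another one, the two agree. -/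
theorem eq_of_le_of_isCompl {α : Type*} [Lattice α] [BoundedOrder α] [IsModularLattice α]
    {a b c d : α} (hac : a ≤ c) (hbd : b ≤ d) (hab : Codisjoint a b) (hcd : Disjoint c d) :
    a = c := by
  have h : (a ⊔ b) ⊓ c = a ⊔ b ⊓ c := sup_inf_assoc_of_le b hac
  rwa [hab.eq_top, top_inf_eq, (hcd.symm.mono_left hbd).eq_bot, sup_bot_eq, eq_comm] at h

theorem injective_of_isometry (hB' : B.Nondegenerate) {φ : V →ₗ[ℝ] V}
    (hφ : ∀ x y, B (φ x) (φ y) = B x y) : Function.Injective φ := by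
  rw [injective_iff_map_eq_zero]
  refine fun x hx => hB'.1 x fun y => ?_
  rw [← hφ, hx, LinearMap.map_zero₂]

namespace IsFixedSplitting

variable {N₀ N₁ : Submodule ℝ V}

theorem projection_add_projection (hN : IsFixedSplitting B G N₀ N₁) (x : V) :
    N₀.projection N₁ hN.isCompl x + N₁.projection N₀ hN.isCompl.symm x = x :=
  Submodule.projection_add_projection_eq_self hN.isCompl x

/-- The projection onto `N₀` preserves the scalar product on the fixed space. -/
theorem form_projection_of_mem_fixedIn (hN : IsFixedSplitting B G N₀ N₁) (hB : B.IsSymm) {x y : V}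
    (hx : x ∈ fixedIn G ⊤) (hy : y ∈ fixedIn G ⊤) :
    B (N₀.projection N₁ hN.isCompl x) (N₀.projection N₁ hN.isCompl y) = B x y := by
  have key : ∀ x ∈ fixedIn G ⊤, ∃ x₀ ∈ N₀, ∃ x₁ ∈ fixedIn G N₁, x₀ + x₁ = x ∧
      N₀.projection N₁ hN.isCompl x = x₀ := fun x hx => by
    obtain ⟨x₀, h₀, x₁, h₁, rfl⟩ := hN.exists_add_eq hx
    refine ⟨x₀, h₀, x₁, h₁, rfl, ?_⟩
    rw [map_add, Submodule.projection_apply_of_mem_left _ h₀,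
      Submodule.projection_apply_of_mem_right _ h₁.1, add_zero]
  obtain ⟨x₀, hx₀, x₁, hx₁, rfl, hpx⟩ := key x hx
  obtain ⟨y₀, hy₀, y₁, hy₁, rfl, hpy⟩ := key y hy
  rw [hpx, hpy, map_add, map_add, LinearMap.add_apply, LinearMap.add_apply,
    hN.orthogonal _ hx₀ _ hy₁.1, hB.isRefl _ _ (hN.orthogonal _ hy₀ _ hx₁.1),
    hN.isotropic _ hx₁ _ hy₁]
  ring

theorem form_projection_symm_left (hN : IsFixedSplitting B G N₀ N₁) (x : V) {y : V} (hy : y ∈ N₁) :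
    B (N₁.projection N₀ hN.isCompl.symm x) y = B x y := by
  have h := congrArg (fun z => B z y) (hN.projection_add_projection x)
  rwa [map_add, LinearMap.add_apply,
    hN.orthogonal _ (Submodule.projection_apply_mem _ x) _ hy, zero_add] at h

theorem form_projection_symm (hN : IsFixedSplitting B G N₀ N₁) (hB : B.IsSymm) (x y : V) :
    B (N₁.projection N₀ hN.isCompl.symm x) (N₁.projection N₀ hN.isCompl.symm y) =
      B x y - B (N₀.projection N₁ hN.isCompl x) (N₀.projection N₁ hN.isCompl y) := by
  have hx := hN.projection_add_projection x
  have hy := hN.projection_add_projection y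
  have hx₀ := Submodule.projection_apply_mem hN.isCompl x
  have hy₀ := Submodule.projection_apply_mem hN.isCompl y
  have hx₁ := Submodule.projection_apply_mem hN.isCompl.symm x
  have hy₁ := Submodule.projection_apply_mem hN.isCompl.symm y
  generalize N₀.projection N₁ hN.isCompl x = x₀ at *
  generalize N₁.projection N₀ hN.isCompl.symm x = x₁ at *
  generalize N₀.projection N₁ hN.isCompl y = y₀ at *
  generalize N₁.projection N₀ hN.isCompl.symm y = y₁ at *
  rw [← hx, ← hy, map_add, map_add, LinearMap.add_apply, LinearMap.add_apply,
    hN.orthogonal _ hx₀ _ hy₁, hB.isRefl _ _ (hN.orthogonal _ hy₀ _ hx₁)]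
  ring

variable {M₀ M₁ : Submodule ℝ V} {r k : ℕ} {b : Module.Basis (Fin r ⊕ Fin k ⊕ Fin r) ℝ M₁}

/-- The `eᵢ` span the radical of the fixed space, which is the fixed space of `N₁` as well. -/
theorem basis_e_mem (hM : IsFixedSplitting B G M₀ M₁) (hN : IsFixedSplitting B G N₀ N₁)
    (hb : IsHyperbolicBasis B G M₁ b) (i : Fin r) : (b (.inl i) : V) ∈ fixedIn G N₁ := by
  rw [hN.fixedIn_eq, ← hM.fixedIn_eq, ← hb.span_e]
  exact Submodule.subset_span (mem_range_self i)

/-- The `aⱼ` lie in the displacement space, which is the same for all splittings. -/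
theorem basis_a_mem (hM : IsFixedSplitting B G M₀ M₁) (hN : IsFixedSplitting B G N₀ N₁)
    (hb : IsHyperbolicBasis B G M₁ b) (j : Fin k) : (b (.inr (.inl j)) : V) ∈ N₁ := by
  refine hN.displacementSpan_le ?_
  rw [hN.displacementSpan_eq, ← hM.displacementSpan_eq, ← hb.span_ea]
  exact Submodule.subset_span (Or.inr (mem_range_self j))

/-- The image of the basis vector `f_s` of `M₁` under the comparison map of two splittings: the
projection `p₁ f_s` onto `N₁`, corrected by a combination of the fixed vectors `e_l` that cancels
the scalar products `⟨p₁ f_s, p₁ f_t⟩ = -⟨p₀ f_s, p₀ f_t⟩`. -/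
noncomputable def correctedProjection (hN : IsFixedSplitting B G N₀ N₁)
    (b : Module.Basis (Fin r ⊕ Fin k ⊕ Fin r) ℝ M₁) (s : Fin r) : V :=
  N₁.projection N₀ hN.isCompl.symm (b (.inr (.inr s)))
    + ((1 / 2 : ℝ) * B (N₀.projection N₁ hN.isCompl (b (.inr (.inr s))))
        (N₀.projection N₁ hN.isCompl (b (.inr (.inr s))))) • (b (.inl s) : V)
    + ∑ l ∈ Finset.Ioi s, (B (N₀.projection N₁ hN.isCompl (b (.inr (.inr s))))
        (N₀.projection N₁ hN.isCompl (b (.inr (.inr l))))) • (b (.inl l) : V)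

theorem correctedProjection_mem (hM : IsFixedSplitting B G M₀ M₁)
    (hN : IsFixedSplitting B G N₀ N₁) (hb : IsHyperbolicBasis B G M₁ b) (s : Fin r) :
    hN.correctedProjection b s ∈ N₁ :=
  N₁.add_mem (N₁.add_mem (Submodule.projection_apply_mem _ _)
    (N₁.smul_mem _ (hM.basis_e_mem hN hb s).1))
    (N₁.sum_mem fun l _ => N₁.smul_mem _ (hM.basis_e_mem hN hb l).1)

theorem form_correctedProjection_e (hM : IsFixedSplitting B G M₀ M₁)
    (hN : IsFixedSplitting B G N₀ N₁) (hB : B.IsSymm) (hb : IsHyperbolicBasis B G M₁ b)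
    (s i : Fin r) :
    B (b (.inl i)) (hN.correctedProjection b s) = if i = s then 1 else 0 := by
  have h : B (b (.inl i)) (N₁.projection N₀ hN.isCompl.symm (b (.inr (.inr s)))) =
      if i = s then 1 else 0 := by
    rw [hB.eq, hN.form_projection_symm_left _ (hM.basis_e_mem hN hb i).1, hB.eq, hb.ef]
  simp [correctedProjection, h, hb.ee]

theorem form_correctedProjection_a (hM : IsFixedSplitting B G M₀ M₁)
    (hN : IsFixedSplitting B G N₀ N₁) (hB : B.IsSymm) (hb : IsHyperbolicBasis B G M₁ b)
    (s : Fin r) (j : Fin k) :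
    B (b (.inr (.inl j))) (hN.correctedProjection b s) = 0 := by
  have h : B (b (.inr (.inl j))) (N₁.projection N₀ hN.isCompl.symm (b (.inr (.inr s)))) = 0 := by
    rw [hB.eq, hN.form_projection_symm_left _ (hM.basis_a_mem hN hb j), hB.eq, hb.af]
  simp [correctedProjection, h, hB.eq (b (.inr (.inl j))) (b (.inl _)), hb.ea]

theorem form_correctedProjection (hM : IsFixedSplitting B G M₀ M₁)
    (hN : IsFixedSplitting B G N₀ N₁) (hB : B.IsSymm) (hb : IsHyperbolicBasis B G M₁ b)
    (s t : Fin r) :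
    B (hN.correctedProjection b s) (hN.correctedProjection b t) = 0 := by
  have h₁ : ∀ t, ∀ y, B (b (.inl t)) (N₁.projection N₀ hN.isCompl.symm y) = B (b (.inl t)) y :=
    fun t y => by
      rw [hB.eq, hN.form_projection_symm_left _ (hM.basis_e_mem hN hb t).1, hB.eq]
  have h₂ : ∀ y t, B (N₁.projection N₀ hN.isCompl.symm y) (b (.inl t)) = B (b (.inl t)) y :=
    fun y t => by rw [hB.eq, h₁]
  rw [correctedProjection, correctedProjection]
  simp only [map_add, LinearMap.add_apply, map_smul, LinearMap.smul_apply, map_sum,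
    LinearMap.sum_apply, smul_eq_mul, hN.form_projection_symm hB, hb.ff, hb.ee, h₁, h₂, hb.ef]
  simp only [mul_ite, mul_one, mul_zero, Finset.sum_ite_eq', Finset.sum_const_zero, Finset.mem_Ioi]
  -- What cancels `-c_st`, where `c_st = ⟨p₀ f_s, p₀ f_t⟩`, is the term `c_st e_t` in the image of
  -- `f_s` for `s < t`, the two halves of `c_ss` for `s = t`, and the term `c_ts e_s` for `t < s`.
  rcases lt_trichotomy s t with h | rfl | h
  · simp [h, h.ne, h.ne', h.not_gt]
  · simp
    ring
  · simp [h, h.ne, h.ne', h.not_gt, hB.eq (N₀.projection N₁ hN.isCompl (b (.inr (.inr t))))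
      (N₀.projection N₁ hN.isCompl (b (.inr (.inr s))))]

/-- The comparison map of two splittings: the projection onto `N₀` on `M₀`, and on `M₁` the map
fixing the `eᵢ` and `aⱼ` and sending the `f_s` to their corrected projections. -/
noncomputable def comparison (hM : IsFixedSplitting B G M₀ M₁) (hN : IsFixedSplitting B G N₀ N₁)
    (b : Module.Basis (Fin r ⊕ Fin k ⊕ Fin r) ℝ M₁) : V →ₗ[ℝ] V :=
  LinearMap.ofIsCompl hM.isCompl (N₀.projection N₁ hN.isCompl ∘ₗ M₀.subtype)
    (b.constr ℝ (Sum.elim (fun i => (b (.inl i) : V))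
      (Sum.elim (fun j => (b (.inr (.inl j)) : V)) (hN.correctedProjection b))))

theorem comparison_apply_left (hM : IsFixedSplitting B G M₀ M₁) (hN : IsFixedSplitting B G N₀ N₁)
    (b : Module.Basis (Fin r ⊕ Fin k ⊕ Fin r) ℝ M₁) {x : V} (hx : x ∈ M₀) :
    hM.comparison hN b x = N₀.projection N₁ hN.isCompl x :=
  LinearMap.ofIsCompl_apply_left hM.isCompl (⟨x, hx⟩ : M₀)

theorem comparison_apply_basis (hM : IsFixedSplitting B G M₀ M₁)
    (hN : IsFixedSplitting B G N₀ N₁) (b : Module.Basis (Fin r ⊕ Fin k ⊕ Fin r) ℝ M₁)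
    (i : Fin r ⊕ Fin k ⊕ Fin r) :
    hM.comparison hN b (b i) = Sum.elim (fun i => (b (.inl i) : V))
      (Sum.elim (fun j => (b (.inr (.inl j)) : V)) (hN.correctedProjection b)) i := by
  rw [comparison, LinearMap.ofIsCompl_apply_right, Module.Basis.constr_basis]

theorem comparison_mem_right (hM : IsFixedSplitting B G M₀ M₁) (hN : IsFixedSplitting B G N₀ N₁)
    (hb : IsHyperbolicBasis B G M₁ b) {x : V} (hx : x ∈ M₁) : hM.comparison hN b x ∈ N₁ := by
  rw [← span_range_coe_basis b] at hx
  refine (Submodule.span_le (p := N₁.comap (hM.comparison hN b))).2 ?_ hx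
  rintro _ ⟨i, rfl⟩
  show hM.comparison hN b (b i) ∈ N₁
  rw [comparison_apply_basis]
  rcases i with i | i | i
  · exact (hM.basis_e_mem hN hb i).1
  · exact hM.basis_a_mem hN hb i
  · exact hM.correctedProjection_mem hN hb i

theorem form_comparison_basis (hM : IsFixedSplitting B G M₀ M₁) (hN : IsFixedSplitting B G N₀ N₁)
    (hB : B.IsSymm) (hb : IsHyperbolicBasis B G M₁ b) (i j : Fin r ⊕ Fin k ⊕ Fin r) :
    B (hM.comparison hN b (b i)) (hM.comparison hN b (b j)) = B (b i) (b j) := by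
  have he := hM.form_correctedProjection_e hN hB hb
  have ha := hM.form_correctedProjection_a hN hB hb
  rw [comparison_apply_basis, comparison_apply_basis]
  rcases i with i | i | i <;> rcases j with j | j | j <;>
    simp only [Sum.elim_inl, Sum.elim_inr]
  · rw [he, hb.ef]
  · rw [ha, hb.af]
  · rw [hB.eq, he, hB.eq, hb.ef]
  · rw [hB.eq, ha, hB.eq, hb.af]
  · rw [hM.form_correctedProjection hN hB hb, hb.ff]

theorem form_comparison (hM : IsFixedSplitting B G M₀ M₁) (hN : IsFixedSplitting B G N₀ N₁)
    (hB : B.IsSymm) (hb : IsHyperbolicBasis B G M₁ b) (x y : V) :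
    B (hM.comparison hN b x) (hM.comparison hN b y) = B x y := by
  have h₁ : ∀ x ∈ M₁, ∀ y ∈ M₁,
      B (hM.comparison hN b x) (hM.comparison hN b y) = B x y := fun x hx y hy => by
    have h : LinearMap.BilinForm.restrict
        (B.compl₁₂ (hM.comparison hN b) (hM.comparison hN b)) M₁ = B.restrict M₁ :=
      LinearMap.BilinForm.ext_basis b fun i j => hM.form_comparison_basis hN hB hb i j
    exact LinearMap.congr_fun₂ h ⟨x, hx⟩ ⟨y, hy⟩
  have h₀₁ : ∀ x ∈ M₀, ∀ y ∈ M₁, B (hM.comparison hN b x) (hM.comparison hN b y) = 0 :=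
    fun x hx y hy => by
      rw [hM.comparison_apply_left hN b hx]
      exact hN.orthogonal _ (Submodule.projection_apply_mem _ x) _
        (hM.comparison_mem_right hN hb hy)
  obtain ⟨x₀, hx₀, x₁, hx₁, rfl⟩ := Submodule.mem_sup.1
    (hM.isCompl.sup_eq_top ▸ Submodule.mem_top : x ∈ M₀ ⊔ M₁)
  obtain ⟨y₀, hy₀, y₁, hy₁, rfl⟩ := Submodule.mem_sup.1
    (hM.isCompl.sup_eq_top ▸ Submodule.mem_top : y ∈ M₀ ⊔ M₁)
  simp only [map_add, LinearMap.add_apply]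
  rw [h₁ _ hx₁ _ hy₁, h₀₁ _ hx₀ _ hy₁, hB.eq (hM.comparison hN b x₁), h₀₁ _ hy₀ _ hx₁,
    hM.comparison_apply_left hN b hx₀, hM.comparison_apply_left hN b hy₀,
    hN.form_projection_of_mem_fixedIn hB (hM.le_fixed hx₀) (hM.le_fixed hy₀),
    hM.orthogonal _ hx₀ _ hy₁, hB.eq x₁ y₀, hM.orthogonal _ hy₀ _ hx₁]

/-- Two splittings are related by an isometry, given explicitly on a hyperbolic basis. -/
theorem exists_isometry [FiniteDimensional ℝ V] (hM : IsFixedSplitting B G M₀ M₁)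
    (hN : IsFixedSplitting B G N₀ N₁) (hB : B.IsSymm) (hB' : B.Nondegenerate)
    (hb : IsHyperbolicBasis B G M₁ b) :
    ∃ Φ : V ≃ₗ[ℝ] V, (∀ x y, B (Φ x) (Φ y) = B x y) ∧
      M₀.map (Φ : V →ₗ[ℝ] V) = N₀ ∧ M₁.map (Φ : V →ₗ[ℝ] V) = N₁ ∧
      (∀ x ∈ M₀, Φ x = N₀.projection N₁ hN.isCompl x) ∧
      (∀ i : Fin r, Φ (b (.inl i)) = b (.inl i)) ∧
      (∀ j : Fin k, Φ (b (.inr (.inl j))) = b (.inr (.inl j))) ∧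
      ∀ s : Fin r, Φ (b (.inr (.inr s))) = hN.correctedProjection b s := by
  have hform := hM.form_comparison hN hB hb
  let Φ : V ≃ₗ[ℝ] V :=
    LinearEquiv.ofInjectiveEndo (hM.comparison hN b) (injective_of_isometry hB' hform)
  have h₀ : M₀.map (Φ : V →ₗ[ℝ] V) ≤ N₀ := by
    rintro _ ⟨x, hx, rfl⟩
    show hM.comparison hN b x ∈ N₀
    rw [hM.comparison_apply_left hN b hx]
    exact Submodule.projection_apply_mem _ x
  have h₁ : M₁.map (Φ : V →ₗ[ℝ] V) ≤ N₁ := by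
    rintro _ ⟨x, hx, rfl⟩
    exact hM.comparison_mem_right hN hb hx
  have htop : Codisjoint (M₀.map (Φ : V →ₗ[ℝ] V)) (M₁.map (Φ : V →ₗ[ℝ] V)) := by
    rw [codisjoint_iff, ← Submodule.map_sup, hM.isCompl.sup_eq_top, Submodule.map_top,
      LinearEquiv.range]
  exact ⟨Φ, hform, eq_of_le_of_isCompl h₀ h₁ htop hN.isCompl.disjoint,
    eq_of_le_of_isCompl h₁ h₀ htop.symm hN.isCompl.disjoint.symm,
    fun x hx => hM.comparison_apply_left hN b hx,
    fun i => hM.comparison_apply_basis hN b (.inl i),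
    fun j => hM.comparison_apply_basis hN b (.inr (.inl j)),
    fun s => hM.comparison_apply_basis hN b (.inr (.inr s))⟩

end IsFixedSplitting

end LinearAlgebra

/-! ### The tangent space under holonomy -/

section Holonomy

variable {E : Type*} [NormedAddCommGroup E] [NormedSpace ℝ E]
  {M : Type*} [TopologicalSpace M] [ChartedSpace E M] [IsManifold 𝓘(ℝ, E) ∞ M]

theorem PseudoRiemannianMetric.form_isSymm (g : PseudoRiemannianMetric E M) (m : M) :
    (g.form m).IsSymm :=
  ⟨g.symm m⟩

theorem PseudoRiemannianMetric.form_nondegenerate (g : PseudoRiemannianMetric E M) (m : M) :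
    (g.form m).Nondegenerate :=
  ⟨fun v hv => g.nondegenerate m v hv,
    fun v hv => g.nondegenerate m v fun w => (g.symm m v w).trans (hv w)⟩

theorem PseudoRiemannianMetric.form_apply_of_mem_holonomy [FiniteDimensional ℝ E]
    (g : PseudoRiemannianMetric E M) (m : M) :
    ∀ h ∈ g.holonomy m, ∀ x y, g.form m (h x) (h y) = g.form m x y :=
  fun _ hh x y => PseudoRiemannianMetric.IsTransport.inner_apply_apply hh x y

end Holonomy

end PseudoRiem

theorem theorem3p8 {E : Type*} [NormedAddCommGroup E] [NormedSpace ℝ E] [FiniteDimensional ℝ E]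
    {M : Type*} [TopologicalSpace M] [T2Space M] [SecondCountableTopology M]
    [ChartedSpace E M] [IsManifold 𝓘(ℝ, E) ∞ M]
    (g : PseudoRiem.PseudoRiemannianMetric E M) (m : M)
    (hiso : ¬ PseudoRiem.IsIsotropic (g.form m) (PseudoRiem.fixedIn (g.holonomy m) ⊤)) :
    -- existence of the splitting
    (∃ M₀ M₁ : Submodule ℝ (TangentSpace 𝓘(ℝ, E) m),
      PseudoRiem.IsFixedSplitting (g.form m) (g.holonomy m) M₀ M₁) ∧
    -- uniqueness up to an explicit distance-preserving linear map
    ∀ M₀ M₁ N₀ N₁ : Submodule ℝ (TangentSpace 𝓘(ℝ, E) m),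
      PseudoRiem.IsFixedSplitting (g.form m) (g.holonomy m) M₀ M₁ →
      ∀ hN : PseudoRiem.IsFixedSplitting (g.form m) (g.holonomy m) N₀ N₁,
      (∃ (r k : ℕ) (b : Module.Basis (Fin r ⊕ Fin k ⊕ Fin r) ℝ M₁),
        PseudoRiem.IsHyperbolicBasis (g.form m) (g.holonomy m) M₁ b) ∧
      ∀ (r k : ℕ) (b : Module.Basis (Fin r ⊕ Fin k ⊕ Fin r) ℝ M₁),
        PseudoRiem.IsHyperbolicBasis (g.form m) (g.holonomy m) M₁ b →
        ∃ Φ : TangentSpace 𝓘(ℝ, E) m ≃ₗ[ℝ] TangentSpace 𝓘(ℝ, E) m,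
          (∀ x y, g.form m (Φ x) (Φ y) = g.form m x y) ∧
          M₀.map (Φ : TangentSpace 𝓘(ℝ, E) m →ₗ[ℝ] TangentSpace 𝓘(ℝ, E) m) = N₀ ∧
          M₁.map (Φ : TangentSpace 𝓘(ℝ, E) m →ₗ[ℝ] TangentSpace 𝓘(ℝ, E) m) = N₁ ∧
          (∀ x ∈ M₀, Φ x = N₀.projection N₁ hN.isCompl x) ∧
          (∀ i : Fin r, Φ (b (.inl i)) = b (.inl i)) ∧
          (∀ j : Fin k, Φ (b (.inr (.inl j))) = b (.inr (.inl j))) ∧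
          ∀ s : Fin r, Φ (b (.inr (.inr s))) =
            N₁.projection N₀ hN.isCompl.symm (b (.inr (.inr s)))
            + ((1 / 2 : ℝ) * g.form m (N₀.projection N₁ hN.isCompl (b (.inr (.inr s))))
                (N₀.projection N₁ hN.isCompl (b (.inr (.inr s))))) •
                (b (.inl s) : TangentSpace 𝓘(ℝ, E) m)
            + ∑ l ∈ Finset.Ioi s,
                (g.form m (N₀.projection N₁ hN.isCompl (b (.inr (.inr s))))
                  (N₀.projection N₁ hN.isCompl (b (.inr (.inr l))))) •
                (b (.inl l) : TangentSpace 𝓘(ℝ, E) m) := by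
  have hB := g.form_isSymm m
  have hB' := g.form_nondegenerate m
  have hG := g.form_apply_of_mem_holonomy m
  have : FiniteDimensional ℝ (TangentSpace 𝓘(ℝ, E) m) := ‹FiniteDimensional ℝ E›
  exact ⟨PseudoRiem.exists_isFixedSplitting hB hG, fun M₀ M₁ N₀ N₁ hM hN =>
    ⟨hM.exists_isHyperbolicBasis hB hB' hG, fun r k b hb => hM.exists_isometry hN hB hB' hb⟩⟩
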